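/- Let $V=\bigoplus_{k\in\mathbb Z}V_{(k)}$ be a vertex operator algebra over $\mathbb{C}$ (with $\dim V_{(k)}<\infty$ and $V_{(k)}=0$ for $k\ll 0$), with vacuum $\mathbf 1$ and Virasoro operators $L(k)$. For $n\in\mathbb{N}$, let $O_n(V)\subset V$ be the subspace spanned by all $$u\circ_n v=\operatorname{Res}_x\frac{(1+x)^{\mathrm{wt}\,u+n}\,Y(u,x)v}{x^{2n+2}}\qquad(u\in V\text{ homogeneous},\ v\in V)$$ and all $(L(-1)+L(0))v$, $v\in V$. Let $A_n(V)=V/O_n(V)$ be the level $n$ Zhu algebra, that is, the unital associative algebra with unit $\mathbf 1+O_n(V)$ and with product $(u+O_n(V))(v+O_n(V))=u*_nv+O_n(V)$, where $$u*_n v=\sum_{m=0}^n(-1)^m\binom{m+n}{n}\operatorname{Res}_x\frac{(1+x)^{\mathrm{wt}\,u+n}\,Y(u,x)v}{x^{n+m+1}}$$ for homogeneous $u$, extended linearly to all $u\in V$. Let $n\ge 1$, let $(v_j)_{j\in J}$ be a family of elements of $V$ such that $S_n=\{v_j+O_n(V)\}_{j\in J}$ generates $A_n(V)$ as a unital algebra,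 and let $R=\mathbb{C}\langle x_j\mid j\in J\rangle$ be the free unital associative algebra. Then: (i) $S_{n-1}=\{v_j+O_{n-1}(V)\}_{j\in J}$ generates $A_{n-1}(V)$. Moreover, there are two-sided ideals $I_{n-1}$ and $I_n$ of $R$ such that (ii) $A_{n-1}(V)\cong R/I_{n-1}$ by an isomorphism of unital algebras that sends $v_j+O_{n-1}(V)$ to $x_j+I_{n-1}$ for every $j\in J$; (iii) $A_n(V)\cong R/I_n$ by an isomorphism of unital algebras that sends $v_j+O_n(V)$ to $x_j+I_n$ for every $j\in J$; (iv) $I_n\subset I_{n-1}$. -/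

import Mathlib

noncomputable section

/-- The mode `u_k : V → V` of `Y(u, x) = ∑ k, u_k x^(-k-1)`, for a state-field map `Y` with values
in the vertex operators on `V` (so that `u_k v = 0` for `k` large is built in). -/
def vmode {V : Type*} [AddCommGroup V] [Module ℂ V] (Y : V →ₗ[ℂ] VertexOperator ℂ V)
    (u : V) (k : ℤ) : Module.End ℂ V :=
  VertexOperator.ncoeff (Y u) k

/-- A vertex operator algebra structure on a complex vector space `V`. -/
structure VertexOperatorAlgebra (V : Type*) [AddCommGroup V] [Module ℂ V] where
  /-- the state-field correspondence `u ↦ Y(u, x)` -/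
  Y : V →ₗ[ℂ] VertexOperator ℂ V
  /-- the vacuum vector `𝟏` -/
  vacuum : V
  /-- the conformal vector `ω`; its modes are `L(k) = ω_{k+1}` -/
  conformal : V
  /-- the central charge -/
  centralCharge : ℂ
  /-- the weight spaces `V_(k)` -/
  weightSpace : ℤ → Submodule ℂ V
  isInternal : DirectSum.IsInternal weightSpace
  finiteDimensional : ∀ k, FiniteDimensional ℂ (weightSpace k)
  bounded_below : ∃ N : ℤ, ∀ k < N, weightSpace k = ⊥
  vacuum_mem : vacuum ∈ weightSpace 0
  conformal_mem : conformal ∈ weightSpace 2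
  /-- `Y(𝟏, x) = id` -/
  vacuum_mode : ∀ (k : ℤ) (v : V), vmode Y vacuum k v = if k = -1 then v else 0
  /-- `Y(v, x)𝟏` has no singular part, -/
  creation_of_nonneg : ∀ (v : V) (k : ℤ), 0 ≤ k → vmode Y v k vacuum = 0
  /-- and its constant term is `v` -/
  creation : ∀ v : V, vmode Y v (-1) vacuum = v
  /-- the Jacobi identity, in components; all three sums are finite by truncation -/
  jacobi : ∀ (u v w : V) (l m k : ℤ),
    (∑ᶠ i : ℕ, Ring.choose m i • vmode Y (vmode Y u (l + i) v) (m + k - i) w) =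
      (∑ᶠ i : ℕ, ((-1) ^ i * Ring.choose l i : ℤ) •
        vmode Y u (m + l - i) (vmode Y v (k + i) w)) -
      ((-1 : ℂ) ^ l) • ∑ᶠ i : ℕ, ((-1) ^ i * Ring.choose l i : ℤ) •
        vmode Y v (l + k - i) (vmode Y u (m + i) w)
  /-- the Virasoro relations -/
  virasoro : ∀ (m k : ℤ) (v : V),
    vmode Y conformal (m + 1) (vmode Y conformal (k + 1) v) -
        vmode Y conformal (k + 1) (vmode Y conformal (m + 1) v) =
      ((m : ℂ) - k) • vmode Y conformal (m + k + 1) v +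
        (if m + k = 0 then (((m : ℂ) ^ 3 - m) / 12) * centralCharge else 0) • v
  /-- `L(0) v = k v` for `v ∈ V_(k)` -/
  L_zero : ∀ (k : ℤ), ∀ v ∈ weightSpace k, vmode Y conformal 1 v = (k : ℂ) • v
  /-- `Y(L(-1)v, x) = d/dx Y(v, x)` -/
  L_neg_one : ∀ (v : V) (k : ℤ),
    vmode Y (vmode Y conformal 0 v) k = -(k : ℂ) • vmode Y v (k - 1)

namespace VertexOperatorAlgebra

variable {V : Type*} [AddCommGroup V] [Module ℂ V] (𝒱 : VertexOperatorAlgebra V)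

/-- The mode `u_k` of the field `Y(u, x)`. -/
def mode (u : V) (k : ℤ) : Module.End ℂ V := vmode 𝒱.Y u k

/-- The Virasoro operator `L(k) = ω_{k+1}`. -/
def L (k : ℤ) : Module.End ℂ V := 𝒱.mode 𝒱.conformal (k + 1)

theorem exists_mode_eq_zero (u v : V) : ∃ N : ℤ, ∀ k : ℤ, N ≤ k → 𝒱.mode u k v = 0 := by
  refine ⟨-((HahnModule.of ℂ).symm (𝒱.Y u v)).order, fun k hk => ?_⟩
  exact VertexOperator.ncoeff_eq_zero_of_lt_order (𝒱.Y u) k v (by omega)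

theorem finite_support_res (a p : ℤ) (u v : V) :
    (Function.support fun i : ℕ => Ring.choose a i • 𝒱.mode u (i - p) v).Finite := by
  obtain ⟨N, hN⟩ := 𝒱.exists_mode_eq_zero u v
  refine (Set.finite_Iio (N + p).toNat).subset fun i hi => ?_
  by_contra h
  refine hi ?_
  have h' : (N + p).toNat ≤ i := by simpa using h
  simp [hN (i - p) (by omega)]

/-- The bilinear map `(u, v) ↦ Res_x (1 + x)^a Y(u, x) v / x^p`, where `(1 + x)^a` is expanded in
nonnegative powers of `x`; that is, `∑ i ≥ 0, (a choose i) u_{i-p} v`. -/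
def res (a p : ℤ) : V →ₗ[ℂ] V →ₗ[ℂ] V :=
  LinearMap.mk₂ ℂ (fun u v => ∑ᶠ i : ℕ, Ring.choose a i • 𝒱.mode u (i - p) v)
    (fun u u' v => by
      rw [← finsum_add_distrib (𝒱.finite_support_res a p u v) (𝒱.finite_support_res a p u' v)]
      exact finsum_congr fun i => by simp [mode, vmode])
    (fun c u v => by
      rw [smul_finsum' c (𝒱.finite_support_res a p u v)]
      exact finsum_congr fun i => by
        simp only [mode, vmode, map_smul, Pi.smul_apply, LinearMap.smul_apply]
        exact smul_comm _ _ _)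
    (fun u v v' => by
      rw [← finsum_add_distrib (𝒱.finite_support_res a p u v) (𝒱.finite_support_res a p u v')]
      exact finsum_congr fun i => by simp)
    (fun c u v => by
      rw [smul_finsum' c (𝒱.finite_support_res a p u v)]
      exact finsum_congr fun i => by
        rw [map_smul]
        exact smul_comm _ _ _)

/-- The circle product `u ∘_n v` for `u` homogeneous of weight `k`. -/
def circ (n : ℕ) (k : ℤ) (u v : V) : V := 𝒱.res (k + n) (2 * n + 2) u v

/-- The product `u *_n v` for `u` homogeneous of weight `k` (the formula makes sense for all `u`). -/
def starHomogeneous (n : ℕ) (k : ℤ) : V →ₗ[ℂ] V →ₗ[ℂ] V :=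
  ∑ m ∈ Finset.range (n + 1),
    ((-1) ^ m * ((m + n).choose n : ℤ) : ℤ) • 𝒱.res (k + n) (n + m + 1)

theorem bijective_coeLinearMap : Function.Bijective (DirectSum.coeLinearMap 𝒱.weightSpace) :=
  𝒱.isInternal

/-- The product `u *_n v`, extended linearly in `u` along `V = ⨁ V_(k)`. -/
def star (n : ℕ) : V →ₗ[ℂ] V →ₗ[ℂ] V :=
  (DirectSum.toModule ℂ ℤ (V →ₗ[ℂ] V)
      fun k => (𝒱.starHomogeneous n k).comp (𝒱.weightSpace k).subtype).comp
    (LinearEquiv.ofBijective (DirectSum.coeLinearMap 𝒱.weightSpace)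
      𝒱.bijective_coeLinearMap).symm.toLinearMap

theorem star_of_mem (n : ℕ) (k : ℤ) {u : V} (hu : u ∈ 𝒱.weightSpace k) (v : V) :
    𝒱.star n u v = ∑ m ∈ Finset.range (n + 1),
      ((-1) ^ m * ((m + n).choose n : ℤ) : ℤ) • 𝒱.res (k + n) (n + m + 1) u v := by
  have h : (LinearEquiv.ofBijective (DirectSum.coeLinearMap 𝒱.weightSpace)
      𝒱.bijective_coeLinearMap).symm u = DirectSum.lof ℂ ℤ (fun k => 𝒱.weightSpace k) k ⟨u, hu⟩ := by
    rw [LinearEquiv.symm_apply_eq, LinearEquiv.ofBijective_apply]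
    exact (DirectSum.coeLinearMap_lof 𝒱.weightSpace k ⟨u, hu⟩).symm
  simp only [star, starHomogeneous, LinearMap.comp_apply, LinearEquiv.coe_coe, h,
    DirectSum.toModule_lof, Submodule.subtype_apply, LinearMap.sum_apply, LinearMap.smul_apply]

/-- `O_n(V)`: the span of all `u ∘_n v` with `u` homogeneous, and all `(L(-1) + L(0)) v`. -/
def O (n : ℕ) : Submodule ℂ V :=
  Submodule.span ℂ ({w | ∃ (k : ℤ) (u v : V), u ∈ 𝒱.weightSpace k ∧ w = 𝒱.circ n k u v} ∪
    {w | ∃ v : V, w = 𝒱.L (-1) v + 𝒱.L 0 v})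

/-- The underlying vector space `V / O_n(V)` of the level `n` Zhu algebra `A_n(V)`. Its unit is the
class of the vacuum, and the product of the classes of `u` and `v` is the class of `u *_n v`. -/
abbrev Zhu (n : ℕ) : Type _ := V ⧸ 𝒱.O n

/-- The class `v + O_n(V)`. -/
def cls (n : ℕ) (v : V) : 𝒱.Zhu n := (𝒱.O n).mkQ v

/-- `S` generates `A_n(V)` as a unital algebra: every subspace of `A_n(V)` that contains `S` and the
unit and is closed under the product is all of `A_n(V)`. -/
def Generates (n : ℕ) (S : Set (𝒱.Zhu n)) : Prop :=
  ∀ B : Submodule ℂ (𝒱.Zhu n), S ⊆ B → 𝒱.cls n 𝒱.vacuum ∈ B →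
    (∀ u v : V, 𝒱.cls n u ∈ B → 𝒱.cls n v ∈ B → 𝒱.cls n (𝒱.star n u v) ∈ B) → B = ⊤

/-- The linear isomorphism `e` from `A_n(V)` to the unital associative algebra `A` is an isomorphism
of algebras. In particular `*_n` then induces a well-defined product on `V / O_n(V)`, which is
associative with unit `𝟏 + O_n(V)`. -/
structure IsAlgIso (n : ℕ) {A : Type*} [Ring A] [Algebra ℂ A] (e : 𝒱.Zhu n ≃ₗ[ℂ] A) : Prop where
  map_one : e (𝒱.cls n 𝒱.vacuum) = 1
  map_mul : ∀ u v : V, e (𝒱.cls n (𝒱.star n u v)) = e (𝒱.cls n u) * e (𝒱.cls n v)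

end VertexOperatorAlgebra

end

noncomputable section

open Filter

/-! The identity of `V` induces a surjective algebra map `A_n(V) → A_{n-1}(V)`, because `O_n(V) ⊆
O_{n-1}(V)` (`O_succ_le`) and the products `*_n` and `*_{n-1}` agree modulo `O_{n-1}(V)`
(`star_succ_sub_star_mem`). Hence generators go to generators, and the surjection from the free
algebra onto `A_{n-1}(V)` factors through the one onto `A_n(V)`, so the kernels are nested.

The existence of the two isomorphisms also requires that `*_n` make `V / O_n(V)` a unital
associative algebra, and this takes up most of the proof. All computations use the bilinear maps
`wres a p`, the residues of `(1+x)^(wt u + a) Y(u,x)v / x^p`, which satisfy three rules: Pascal's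
rule (`wres_succ`), membership in `O_n(V)` once `n ≤ a` and `a + n + 2 ≤ p` (`wres_mem_O`), and a
Jacobi identity (`eventually_wres_jacobi`). Choosing its parameters well gives the ideal property of
`O_n(V)` and associativity; the unit law is a separate computation with `L(-1)`. -/

/-! ### Binomial identities. -/

/-- Reindexing of a double sum along antidiagonals. -/
theorem sum_range_sum_range_eq_sum_antidiagonal {M : Type*} [AddCommMonoid M] (N : ℕ)
    (F : ℕ → ℕ → M) (hF : ∀ m k, N ≤ m + k → F m k = 0) :
    ∑ m ∈ Finset.range N, ∑ k ∈ Finset.range N, F m k =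
      ∑ d ∈ Finset.range N, ∑ p ∈ Finset.HasAntidiagonal.antidiagonal d, F p.1 p.2 := by
  have h := Finset.sum_range_diag_flip N F
  simp only [Finset.Nat.sum_antidiagonal_eq_sum_range_succ F]
  rw [show (∑ d ∈ Finset.range N, ∑ k ∈ Finset.range d.succ, F k (d - k)) = _ from h]
  refine Finset.sum_congr rfl fun m _ => ?_
  symm
  refine Finset.sum_subset (Finset.range_mono (Nat.sub_le _ _)) fun k _ hk => hF m k ?_
  simp at hk
  omega

/-- The coefficients of `(1 + x₁)^A (1 + x₂)^B x₁^(-s)`, expanded around `x₁ = x₂`. -/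
theorem sum_choose_mul_choose_mul_choose (A B s : ℤ) (r d : ℕ) :
    ∑ p ∈ Finset.HasAntidiagonal.antidiagonal d,
        Ring.choose A p.1 * Ring.choose B p.2 * Ring.choose ((p.1 : ℤ) - s) r =
      ∑ q ∈ Finset.HasAntidiagonal.antidiagonal r, Ring.choose (-s) q.1 * Ring.choose A q.2 *
        (if q.2 ≤ d then Ring.choose (A + B - q.2) (d - q.2) else 0) := by
  -- Vandermonde is used twice: for `-s + m` here, and for `(A - j) + B` after rewriting `C(A,m)
  -- C(m,j)` as `C(A,j) C(A-j,m-j)`.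
  have h1 : ∀ m : ℕ, Ring.choose ((m : ℤ) - s) r =
      ∑ q ∈ Finset.HasAntidiagonal.antidiagonal r,
        Ring.choose (-s) q.1 * (m.choose q.2 : ℤ) := by
    intro m
    rw [show (m : ℤ) - s = -s + m by ring, Ring.add_choose_eq r (Commute.all _ _)]
    refine Finset.sum_congr rfl fun q _ => ?_
    rw [Ring.choose_natCast]
  simp only [h1, Finset.mul_sum]
  rw [Finset.sum_comm]
  refine Finset.sum_congr rfl fun q _ => ?_
  obtain ⟨i, j⟩ := q
  simp only
  split_ifs with hj
  · rw [show A + B - (j : ℤ) = (A - j) + B by ring,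
      Ring.add_choose_eq (d - j) (Commute.all _ _), Finset.mul_sum]
    simp only [Finset.Nat.sum_antidiagonal_eq_sum_range_succ_mk]
    rw [show d.succ = j + (d - j).succ by omega, Finset.sum_range_add, Finset.sum_eq_zero, zero_add]
    · refine Finset.sum_congr rfl fun k _ => ?_
      have h2 := Ring.choose_smul_choose A (n := j + k) (k := j) (by omega)
      rw [show j + k - j = k by omega, nsmul_eq_mul] at h2
      rw [show d - (j + k) = d - j - k by omega]
      linear_combination (Ring.choose B (d - j - k) * Ring.choose (-s) i) * h2
    · intro m hm
      rw [Nat.choose_eq_zero_of_lt (Finset.mem_range.1 hm)]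
      simp
  · rw [mul_zero]
    refine Finset.sum_eq_zero fun p hp => ?_
    have := Finset.HasAntidiagonal.mem_antidiagonal.1 hp
    rw [Nat.choose_eq_zero_of_lt (show p.1 < j by omega)]
    simp

/-- The two ways of pairing `(1 + x₁)^A (1 + x₂)^B x₁^(-s)` with a finitely supported family. -/
theorem sum_choose_smul_eq_sum_choose_smul {M : Type*} [AddCommGroup M] (A B s : ℤ) (N : ℕ)
    (e : ℕ → ℕ → M) (he : ∀ r d, N ≤ r → e r d = 0) (he' : ∀ r d, N ≤ d → e r d = 0) :
    ∑ m ∈ Finset.range N, ∑ k ∈ Finset.range N, ∑ r ∈ Finset.range N,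
        (Ring.choose A m * Ring.choose B k * Ring.choose ((m : ℤ) - s) r) • e r (m + k) =
      ∑ i ∈ Finset.range N, ∑ j ∈ Finset.range N, ∑ k ∈ Finset.range N,
        (Ring.choose (-s) i * Ring.choose A j * Ring.choose (A + B - j) k) •
          e (i + j) (k + j) := by
  rw [sum_range_sum_range_eq_sum_antidiagonal N (fun m k => ∑ r ∈ Finset.range N,
    (Ring.choose A m * Ring.choose B k * Ring.choose ((m : ℤ) - s) r) • e r (m + k))
    (fun m k h => Finset.sum_eq_zero fun r _ => by rw [he' _ _ h, smul_zero])]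
  have hR : ∀ i j : ℕ, ∑ k ∈ Finset.range N,
      (Ring.choose (-s) i * Ring.choose A j * Ring.choose (A + B - j) k) • e (i + j) (k + j) =
      ∑ d ∈ Finset.range N, (Ring.choose (-s) i * Ring.choose A j *
        (if j ≤ d then Ring.choose (A + B - j) (d - j) else 0)) • e (i + j) d := by
    intro i j
    rw [Finset.sum_subset (s₁ := Finset.range N) (s₂ := Finset.range (j + N))
      (f := fun d => (Ring.choose (-s) i * Ring.choose A j *
        (if j ≤ d then Ring.choose (A + B - j) (d - j) else 0)) • e (i + j) d)
      (Finset.range_mono (by omega))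
      (fun d _ hd => by rw [he' _ d (by simpa using hd), smul_zero]), Finset.sum_range_add,
      Finset.sum_eq_zero (s := Finset.range j), zero_add]
    · refine Finset.sum_congr rfl fun k _ => ?_
      rw [if_pos (by omega), add_tsub_cancel_left, add_comm j k]
    · intro d hd
      rw [if_neg (by simpa using hd), mul_zero, zero_smul]
  simp only [hR]
  rw [sum_range_sum_range_eq_sum_antidiagonal N (fun i j => ∑ d ∈ Finset.range N,
    (Ring.choose (-s) i * Ring.choose A j *
      (if j ≤ d then Ring.choose (A + B - j) (d - j) else 0)) • e (i + j) d)
    (fun m k h => Finset.sum_eq_zero fun r _ => by rw [he _ _ h, smul_zero])]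
  have hL : ∀ d, ∑ p ∈ Finset.HasAntidiagonal.antidiagonal d, ∑ r ∈ Finset.range N,
      (Ring.choose A p.1 * Ring.choose B p.2 * Ring.choose ((p.1 : ℤ) - s) r) • e r (p.1 + p.2) =
      ∑ r ∈ Finset.range N, (∑ p ∈ Finset.HasAntidiagonal.antidiagonal d,
        Ring.choose A p.1 * Ring.choose B p.2 * Ring.choose ((p.1 : ℤ) - s) r) • e r d := by
    intro d
    rw [Finset.sum_comm]
    refine Finset.sum_congr rfl fun r _ => ?_
    rw [Finset.sum_smul]
    refine Finset.sum_congr rfl fun p hp => ?_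
    rw [Finset.HasAntidiagonal.mem_antidiagonal.1 hp]
  simp only [hL]
  rw [Finset.sum_comm]
  refine Finset.sum_congr rfl fun r _ => ?_
  rw [Finset.sum_comm]
  refine Finset.sum_congr rfl fun d _ => ?_
  rw [sum_choose_mul_choose_mul_choose, Finset.sum_smul]
  refine Finset.sum_congr rfl fun q hq => ?_
  rw [Finset.HasAntidiagonal.mem_antidiagonal.1 hq]

/-- An alternating binomial sum over a family satisfying Pascal's rule. -/
theorem sum_neg_one_pow_choose_smul_of_pascal {M : Type*} [AddCommGroup M] (f : ℤ → ℤ → M)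
    (hf : ∀ a s, f (a + 1) (s + 1) = f a (s + 1) + f a s) (r : ℕ) (a s : ℤ) :
    ∑ m ∈ Finset.range (r + 1), ((-1) ^ m * (r.choose m : ℤ)) • f (a + m) (s + m) =
      (-1 : ℤ) ^ r • f a (s + r) := by
  -- With `(1+x)^a x^(-s)` in place of `f a s`, the sum is `(1+x)^a x^(-s) (1 - (1+x)/x)^r`, and the
  -- last factor is `(-1/x)^r`. The induction removes one factor `1 - (1+x)/x` at a time.
  induction r generalizing s with
  | zero => simp
  | succ r ih =>
    have h : ∀ m : ℕ, f (a + m) (s + m) - f (a + (m + 1 : ℕ)) (s + (m + 1 : ℕ)) =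
        -f (a + m) (s + 1 + m) := by
      intro m
      rw [Nat.cast_succ, ← add_assoc, ← add_assoc, hf, add_right_comm s 1]
      abel
    have h2 : ∑ m ∈ Finset.range (r + 1 + 1), ((-1) ^ m * ((r + 1).choose m : ℤ)) •
        f (a + m) (s + m) = ∑ m ∈ Finset.range (r + 1), ((-1) ^ m * (r.choose m : ℤ)) •
        (f (a + m) (s + m) - f (a + (m + 1 : ℕ)) (s + (m + 1 : ℕ))) := by
      simp only [smul_sub, Finset.sum_sub_distrib]
      have h3 := Finset.sum_range_succ (fun m : ℕ => ((-1) ^ m * (r.choose m : ℤ)) •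
        f (a + m) (s + m)) (r + 1)
      rw [Nat.choose_succ_self, Nat.cast_zero, mul_zero, zero_smul, add_zero] at h3
      rw [← h3, Finset.sum_range_succ', Finset.sum_range_succ' _ (r + 1), add_sub_right_comm,
        ← Finset.sum_sub_distrib]
      congr 1
      · refine Finset.sum_congr rfl fun m _ => ?_
        rw [← sub_smul, Nat.choose_succ_succ]
        congr 1
        push_cast
        ring
      · simp
    rw [h2]
    simp only [h, smul_neg, Finset.sum_neg_distrib]
    rw [ih, pow_succ, mul_neg_one, neg_smul, Nat.cast_succ, add_assoc, add_comm (1 : ℤ)]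

namespace VertexOperatorAlgebra

variable {V : Type*} [AddCommGroup V] [Module ℂ V] (𝒱 : VertexOperatorAlgebra V)

/-! ### Modes, weights and the commutator formula. -/

/-- The map `u ↦ u_k`. -/
def modeₗ (k : ℤ) : V →ₗ[ℂ] Module.End ℂ V where
  toFun u := 𝒱.mode u k
  map_add' u v := by simp [mode, vmode]
  map_smul' c u := by simp [mode, vmode]

theorem modeₗ_apply (k : ℤ) (u : V) : 𝒱.modeₗ k u = 𝒱.mode u k := rfl

theorem homogeneous_induction {p : V → Prop} (hadd : ∀ u v, p u → p v → p (u + v))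
    (hom : ∀ (k : ℤ), ∀ u ∈ 𝒱.weightSpace k, p u) (u : V) : p u := by
  have hu : u ∈ ⨆ k, 𝒱.weightSpace k := by
    rw [𝒱.isInternal.submodule_iSup_eq_top]; trivial
  exact Submodule.iSup_induction 𝒱.weightSpace (motive := p) hu (fun k u hu => hom k u hu)
    (hom 0 0 (zero_mem _)) hadd

/-- Converse of the axiom `L_zero`: `L(0)` is diagonal on the direct sum and distinct integers give
distinct eigenvalues. It serves to find the weight of `u_k v`, which is not part of the axioms. -/
theorem mem_weightSpace_of_L_zero (k : ℤ) (v : V)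
    (hv : 𝒱.mode 𝒱.conformal 1 v = (k : ℂ) • v) : v ∈ 𝒱.weightSpace k := by
  classical
  obtain ⟨f, rfl⟩ := 𝒱.bijective_coeLinearMap.2 v
  have key : ∀ g : DirectSum ℤ fun k => 𝒱.weightSpace k,
      𝒱.mode 𝒱.conformal 1 (DirectSum.coeLinearMap 𝒱.weightSpace g) =
        DirectSum.coeLinearMap 𝒱.weightSpace
          (DFinsupp.mapRange.linearMap (fun i : ℤ =>
            ((i : ℂ) • LinearMap.id : 𝒱.weightSpace i →ₗ[ℂ] 𝒱.weightSpace i)) g) := by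
    intro g
    induction g using DirectSum.induction_on with
    | zero => simp
    | of i x =>
      have h1 : DirectSum.of (fun k => 𝒱.weightSpace k) i x =
        DirectSum.lof ℂ ℤ (fun k => 𝒱.weightSpace k) i x := rfl
      have h2 : DFinsupp.mapRange.linearMap (fun i : ℤ =>
            ((i : ℂ) • LinearMap.id : 𝒱.weightSpace i →ₗ[ℂ] 𝒱.weightSpace i))
          (DirectSum.lof ℂ ℤ (fun k => 𝒱.weightSpace k) i x) =
          DirectSum.lof ℂ ℤ (fun k => 𝒱.weightSpace k) i ((i : ℂ) • x) := by
        exact DFinsupp.mapRange_single (hf := fun i => map_zero _)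
      rw [h1, h2, DirectSum.coeLinearMap_lof, DirectSum.coeLinearMap_lof]
      exact 𝒱.L_zero i x x.2
    | add x y hx hy => simp only [map_add, hx, hy]
  rw [key, ← map_smul] at hv
  have h := 𝒱.bijective_coeLinearMap.1 hv
  have hz : ∀ i, i ≠ k → f i = 0 := by
    intro i hi
    have h3 : (i : ℂ) • f i = (k : ℂ) • f i := DFunLike.congr_fun h i
    rw [← sub_eq_zero, ← sub_smul] at h3
    rcases smul_eq_zero.1 h3 with h4 | h4
    · exact absurd (by exact_mod_cast sub_eq_zero.1 h4) hi
    · exact h4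
  have hf : f = DirectSum.lof ℂ ℤ (fun k => 𝒱.weightSpace k) k (f k) := by
    refine DFinsupp.ext fun i => ?_
    by_cases hi : i = k
    · subst hi; exact (DirectSum.of_eq_same (β := fun k => 𝒱.weightSpace k) i (f i)).symm
    · rw [hz i hi]; exact (DirectSum.of_eq_of_ne (β := fun k => 𝒱.weightSpace k) k i (f k) hi).symm
  rw [hf, DirectSum.coeLinearMap_lof]
  exact (f k).2

/-- The Jacobi identity with finite sums. -/
theorem jacobi_mode (u v w : V) (l m k : ℤ) (N : ℕ)
    (h1 : ∀ i, N ≤ i → 𝒱.mode u (l + i) v = 0)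
    (h2 : ∀ i, N ≤ i → 𝒱.mode v (k + i) w = 0)
    (h3 : ∀ i, N ≤ i → 𝒱.mode u (m + i) w = 0) :
    (∑ i ∈ Finset.range N, Ring.choose m i • 𝒱.mode (𝒱.mode u (l + i) v) (m + k - i) w) =
      (∑ i ∈ Finset.range N, ((-1) ^ i * Ring.choose l i : ℤ) •
        𝒱.mode u (m + l - i) (𝒱.mode v (k + i) w)) -
      ((-1 : ℂ) ^ l) • ∑ i ∈ Finset.range N, ((-1) ^ i * Ring.choose l i : ℤ) •
        𝒱.mode v (l + k - i) (𝒱.mode u (m + i) w) := by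
  have h := 𝒱.jacobi u v w l m k
  rw [finsum_eq_sum_of_support_subset (s := Finset.range N),
    finsum_eq_sum_of_support_subset (s := Finset.range N),
    finsum_eq_sum_of_support_subset (s := Finset.range N)] at h
  · exact h
  · intro i hi
    by_contra hN
    refine hi ?_
    have : 𝒱.mode u (m + i) w = 0 := h3 i (by simpa using hN)
    rw [mode] at this
    simp [this]
  · intro i hi
    by_contra hN
    refine hi ?_
    have : 𝒱.mode v (k + i) w = 0 := h2 i (by simpa using hN)
    rw [mode] at this
    simp [this]
  · intro i hi
    by_contra hN
    refine hi ?_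
    have : 𝒱.mode u (l + i) v = 0 := h1 i (by simpa using hN)
    rw [mode] at this
    simp only [this]
    simp [vmode]

theorem exists_nat_mode_eq_zero (u v : V) (p : ℤ) :
    ∃ N : ℕ, ∀ k : ℤ, (N : ℤ) ≤ k + p → 𝒱.mode u k v = 0 := by
  obtain ⟨N, hN⟩ := 𝒱.exists_mode_eq_zero u v
  exact ⟨(N + p).toNat, fun k hk => hN k (by omega)⟩

/-- The Jacobi identity at `l = 0`, where only the terms `i = 0` survive on the right. -/
theorem mode_mode_comm (m k : ℤ) (u v w : V) (N : ℕ)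
    (h1 : ∀ i, N ≤ i → 𝒱.mode u i v = 0) :
    𝒱.mode u m (𝒱.mode v k w) - 𝒱.mode v k (𝒱.mode u m w) =
      ∑ i ∈ Finset.range N, Ring.choose m i • 𝒱.mode (𝒱.mode u i v) (m + k - i) w := by
  obtain ⟨N2, h2⟩ := 𝒱.exists_nat_mode_eq_zero v w (-k)
  obtain ⟨N3, h3⟩ := 𝒱.exists_nat_mode_eq_zero u w (-m)
  have h := 𝒱.jacobi_mode u v w 0 m k (N + N2 + N3 + 1)
    (fun i hi => by rw [zero_add]; exact h1 i (by omega))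
    (fun i hi => h2 _ (by omega)) (fun i hi => h3 _ (by omega))
  rw [Finset.sum_range_succ' (fun i : ℕ => ((-1) ^ i * Ring.choose 0 i : ℤ) •
      𝒱.mode u (m + 0 - i) (𝒱.mode v (k + i) w)),
    Finset.sum_range_succ' (fun i : ℕ => ((-1) ^ i * Ring.choose 0 i : ℤ) •
      𝒱.mode v (0 + k - i) (𝒱.mode u (m + i) w))] at h
  simp only [Ring.choose_zero_succ, mul_zero, zero_smul, Finset.sum_const_zero, zero_add,
    pow_zero, Ring.choose_zero_right, mul_one, one_smul, Nat.cast_zero, add_zero, sub_zero,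
    zpow_zero] at h
  rw [← h]
  symm
  refine Finset.sum_subset (Finset.range_mono (by omega)) fun i _ hi => ?_
  rw [h1 i (by simpa using hi)]
  simp [mode, vmode]


theorem mode_L_neg_one (v : V) (k : ℤ) :
    𝒱.mode (𝒱.L (-1) v) k = -(k : ℂ) • 𝒱.mode v (k - 1) := 𝒱.L_neg_one v k

theorem L_zero_apply {k : ℤ} {v : V} (hv : v ∈ 𝒱.weightSpace k) : 𝒱.L 0 v = (k : ℂ) • v :=
  𝒱.L_zero k v hv

/-- By the commutator formula and the `L(-1)`-derivative property, `[L(0), u_k] = (L(-1)u)_{k+1} +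
(L(0)u)_k = (p - k - 1) u_k`. -/
theorem mode_mem_weightSpace {p q : ℤ} {u v : V} (hu : u ∈ 𝒱.weightSpace p)
    (hv : v ∈ 𝒱.weightSpace q) (k : ℤ) : 𝒱.mode u k v ∈ 𝒱.weightSpace (p + q - k - 1) := by
  refine 𝒱.mem_weightSpace_of_L_zero _ _ ?_
  obtain ⟨N, hN⟩ := 𝒱.exists_nat_mode_eq_zero 𝒱.conformal u 0
  have h := 𝒱.mode_mode_comm 1 k 𝒱.conformal u v (N + 2) (fun i hi => hN _ (by omega))
  rw [Finset.sum_range_succ', Finset.sum_range_succ', Finset.sum_eq_zero, sub_eq_iff_eq_add] at h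
  · have h0 : 𝒱.mode 𝒱.conformal ((0 + 1 : ℕ) : ℤ) u = (p : ℂ) • u := 𝒱.L_zero p u hu
    have h1 : 𝒱.mode 𝒱.conformal ((0 : ℕ) : ℤ) u = 𝒱.L (-1) u := rfl
    have h2 : 𝒱.mode 𝒱.conformal 1 v = (q : ℂ) • v := 𝒱.L_zero q v hv
    rw [h, h0, h1, h2, mode_L_neg_one, ← modeₗ_apply, map_smul, modeₗ_apply]
    simp only [Ring.choose_zero_right, Ring.choose_one_right, zero_add, one_smul, map_smul,
      LinearMap.smul_apply, Nat.cast_one, Nat.cast_zero, sub_zero]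
    rw [show 1 + k - 1 = k by ring, ← add_smul, ← add_smul]
    congr 1
    push_cast
    ring
  · intro i _
    have : Ring.choose (1 : ℤ) (i + 1 + 1) = 0 := by
      have := Ring.choose_natCast (R := ℤ) 1 (i + 1 + 1)
      rw [Nat.cast_one] at this
      rw [this, Nat.choose_eq_zero_of_lt (by omega), Nat.cast_zero]
    rw [this, zero_smul]

/-! ### Weighted residues and their Jacobi identity. -/

theorem res_eq_sum_range (a p : ℤ) (u v : V) (N : ℕ)
    (h : ∀ i, N ≤ i → 𝒱.mode u (i - p) v = 0) :
    𝒱.res a p u v = ∑ i ∈ Finset.range N, Ring.choose a i • 𝒱.mode u (i - p) v := by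
  show ∑ᶠ i : ℕ, Ring.choose a i • 𝒱.mode u (i - p) v = _
  refine finsum_eq_sum_of_support_subset _ fun i hi => ?_
  by_contra hN
  exact hi (by simp only [h i (by simpa using hN), smul_zero])

/-- The bilinear map `(u, v) ↦ Res_x (1 + x)^(wt u + a) Y(u, x) v / x^p`. -/
def wres (a p : ℤ) : V →ₗ[ℂ] V →ₗ[ℂ] V :=
  (DirectSum.toModule ℂ ℤ (V →ₗ[ℂ] V)
      fun k => (𝒱.res (k + a) p).comp (𝒱.weightSpace k).subtype).comp
    (LinearEquiv.ofBijective (DirectSum.coeLinearMap 𝒱.weightSpace)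
      𝒱.bijective_coeLinearMap).symm.toLinearMap

theorem wres_of_mem (a p : ℤ) {k : ℤ} {u : V} (hu : u ∈ 𝒱.weightSpace k) :
    𝒱.wres a p u = 𝒱.res (k + a) p u := by
  have h : (LinearEquiv.ofBijective (DirectSum.coeLinearMap 𝒱.weightSpace)
      𝒱.bijective_coeLinearMap).symm u = DirectSum.lof ℂ ℤ (fun k => 𝒱.weightSpace k) k ⟨u, hu⟩ := by
    rw [LinearEquiv.symm_apply_eq, LinearEquiv.ofBijective_apply]
    exact (DirectSum.coeLinearMap_lof 𝒱.weightSpace k ⟨u, hu⟩).symm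
  simp only [wres, LinearMap.comp_apply, LinearEquiv.coe_coe, h,
    DirectSum.toModule_lof, Submodule.subtype_apply]

theorem star_eq_sum_wres (n : ℕ) (u v : V) :
    𝒱.star n u v = ∑ m ∈ Finset.range (n + 1),
      ((-1) ^ m * ((m + n).choose n : ℤ) : ℤ) • 𝒱.wres n (n + m + 1) u v := by
  induction u using 𝒱.homogeneous_induction with
  | hadd u u' h h' => simp only [map_add, LinearMap.add_apply, h, h', smul_add,
      Finset.sum_add_distrib]
  | hom k u hu => simp only [𝒱.star_of_mem n k hu, 𝒱.wres_of_mem _ _ hu]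

theorem wres_eq_sum_range (a p : ℤ) {k : ℤ} {u : V} (hu : u ∈ 𝒱.weightSpace k) (v : V) (N : ℕ)
    (h : ∀ i, N ≤ i → 𝒱.mode u (i - p) v = 0) :
    𝒱.wres a p u v = ∑ i ∈ Finset.range N, Ring.choose (k + a) i • 𝒱.mode u (i - p) v := by
  rw [𝒱.wres_of_mem a p hu, 𝒱.res_eq_sum_range _ _ _ _ N h]

/-- The identity `(1+x)^(a+1) / x^(p+1) = (1+x)^a / x^(p+1) + (1+x)^a / x^p` under the residue. -/
theorem wres_succ (a p : ℤ) (u v : V) :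
    𝒱.wres (a + 1) (p + 1) u v = 𝒱.wres a (p + 1) u v + 𝒱.wres a p u v := by
  induction u using 𝒱.homogeneous_induction with
  | hadd u u' h h' => simp only [map_add, LinearMap.add_apply, h, h']; abel
  | hom k u hu =>
    obtain ⟨N, hN⟩ := 𝒱.exists_nat_mode_eq_zero u v p
    rw [𝒱.wres_eq_sum_range _ _ hu v (N + 2) (fun i hi => hN _ (by omega)),
      𝒱.wres_eq_sum_range _ _ hu v (N + 2) (fun i hi => hN _ (by omega)),
      𝒱.wres_eq_sum_range _ _ hu v (N + 1) (fun i hi => hN _ (by omega)),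
      Finset.sum_range_succ', Finset.sum_range_succ' _ (N + 1)]
    simp only [Ring.choose_zero_right]
    rw [add_right_comm, ← Finset.sum_add_distrib]
    congr 1
    refine Finset.sum_congr rfl fun i _ => ?_
    rw [← add_assoc, Ring.choose_succ_succ, add_smul, add_comm,
      show ((i + 1 : ℕ) : ℤ) - (p + 1) = i - p by push_cast; ring]

/-- A truncation bound uniform in `c ≥ p`: only finitely many such `c` have `v_c w ≠ 0`. -/
theorem exists_mode_mode_eq_zero (u v w : V) (p : ℤ) :
    ∃ N : ℕ, ∀ c k : ℤ, p ≤ c → (N : ℤ) ≤ k → 𝒱.mode u k (𝒱.mode v c w) = 0 := by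
  obtain ⟨C, hC⟩ := 𝒱.exists_mode_eq_zero v w
  choose f hf using fun c : ℤ => 𝒱.exists_nat_mode_eq_zero u (𝒱.mode v c w) 0
  refine ⟨(Finset.Ico p C).sup f, fun c k hc hk => ?_⟩
  by_cases h : C ≤ c
  · rw [hC c h, map_zero]
  · have := Finset.le_sup (f := f) (Finset.mem_Ico.2 ⟨hc, not_le.1 h⟩)
    exact hf c k (by omega)

theorem exists_mode_mode_eq_zero' (u v w : V) (p : ℤ) :
    ∃ N : ℕ, ∀ c k : ℤ, p ≤ c → (N : ℤ) ≤ k → 𝒱.mode (𝒱.mode u c v) k w = 0 := by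
  obtain ⟨C, hC⟩ := 𝒱.exists_mode_eq_zero u v
  choose f hf using fun c : ℤ => 𝒱.exists_nat_mode_eq_zero (𝒱.mode u c v) w 0
  refine ⟨(Finset.Ico p C).sup f, fun c k hc hk => ?_⟩
  by_cases h : C ≤ c
  · rw [hC c h, ← modeₗ_apply, map_zero, LinearMap.zero_apply]
  · have := Finset.le_sup (f := f) (Finset.mem_Ico.2 ⟨hc, not_le.1 h⟩)
    exact hf c k (by omega)

/-- Iterated residues of a product, in the range where the double sum is finite. -/
theorem eventually_wres_wres_eq_sum (a b c p q : ℤ) {k l : ℤ} {u v : V}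
    (hu : u ∈ 𝒱.weightSpace k) (hv : v ∈ 𝒱.weightSpace l) (w : V) :
    ∀ᶠ N : ℕ in atTop, ∑ i ∈ Finset.range N, ((-1) ^ i * Ring.choose c i : ℤ) •
        𝒱.wres a (p + i) u (𝒱.wres b (q - i) v w) =
      ∑ m ∈ Finset.range N, ∑ j ∈ Finset.range N,
        (Ring.choose (k + a) m * Ring.choose (l + b) j) •
          ∑ i ∈ Finset.range N, ((-1) ^ i * Ring.choose c i : ℤ) •
            𝒱.mode u (m - p - i) (𝒱.mode v (j - q + i) w) := by
  obtain ⟨C, hC⟩ := 𝒱.exists_nat_mode_eq_zero v w q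
  obtain ⟨D, hD⟩ := 𝒱.exists_mode_mode_eq_zero u v w (-q)
  filter_upwards [eventually_ge_atTop (C + D + (p.toNat + C))] with N hN
  -- For `i ≥ C` the inner mode already vanishes; for `i < C` the shift by `i` is bounded, so the
  -- uniform bound `D` applies.
  have hz : ∀ i j m : ℕ, N ≤ m → 𝒱.mode u (m - (p + i)) (𝒱.mode v (j - (q - i)) w) = 0 := by
    intro i j m hm
    by_cases hi : i < C
    · exact hD _ _ (by omega) (by omega)
    · rw [hC _ (by omega), map_zero]
  have h1 : ∀ i : ℕ, 𝒱.wres a (p + i) u (𝒱.wres b (q - i) v w) =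
      ∑ m ∈ Finset.range N, ∑ j ∈ Finset.range N,
        (Ring.choose (k + a) m * Ring.choose (l + b) j) •
          𝒱.mode u (m - p - i) (𝒱.mode v (j - q + i) w) := by
    intro i
    rw [𝒱.wres_eq_sum_range b (q - i) hv w N (fun j hj => hC _ (by omega)), map_sum,
      Finset.sum_comm]
    refine Finset.sum_congr rfl fun j _ => ?_
    rw [map_zsmul, 𝒱.wres_eq_sum_range a (p + i) hu _ N (fun m hm => hz i j m hm),
      Finset.smul_sum]
    refine Finset.sum_congr rfl fun m _ => ?_
    rw [smul_smul, mul_comm, sub_sub, sub_add]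
  simp only [h1, Finset.smul_sum]
  rw [Finset.sum_comm]
  refine Finset.sum_congr rfl fun m _ => ?_
  rw [Finset.sum_comm]
  refine Finset.sum_congr rfl fun j _ => Finset.sum_congr rfl fun i _ => ?_
  rw [smul_smul, smul_smul, mul_comm]

/-- The substitution `x₁ = x₂ + x₀`. Expanding `(1+x₁)^(p+a) (1+x₂)^(q+b) x₁^(-s)` in `x₀` gives the
terms `C(-s,i) C(p+a,j) x₀^(i+j) (1+x₂)^(p+q+a+b-j) x₂^(-s-i)`. The vector `u_{i+j-l} v` has weight
`p + q - (i+j-l) - 1`, so the exponent of `1+x₂` is this weight plus `a + b + 1 + i - l`,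
independently of `j`. -/
theorem eventually_wres_iterate_eq_sum (a b l s t : ℤ) {p q : ℤ} {u v : V}
    (hu : u ∈ 𝒱.weightSpace p) (hv : v ∈ 𝒱.weightSpace q) (w : V) :
    ∀ᶠ N : ℕ in atTop, ∑ i ∈ Finset.range N, Ring.choose (-s) i •
        𝒱.wres (a + b + 1 + i - l) (s + t + i) (𝒱.wres a (l - i) u v) w =
      ∑ m ∈ Finset.range N, ∑ j ∈ Finset.range N,
        (Ring.choose (p + a) m * Ring.choose (q + b) j) •
          ∑ i ∈ Finset.range N, Ring.choose (m - s) i •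
            𝒱.mode (𝒱.mode u (-l + i) v) (m - s + (j - t) - i) w := by
  obtain ⟨C, hC⟩ := 𝒱.exists_nat_mode_eq_zero u v l
  obtain ⟨D, hD⟩ := 𝒱.exists_mode_mode_eq_zero' u v w (-l)
  filter_upwards [eventually_ge_atTop (C + D + (s + t + C).toNat)] with N hN
  set e : ℕ → ℕ → V := fun r d => 𝒱.mode (𝒱.mode u (-l + r) v) (d - s - t - r) w with he_def
  have he : ∀ r d, N ≤ r → e r d = 0 := by
    intro r d hr
    simp only [he_def]
    rw [hC _ (by omega), ← modeₗ_apply, map_zero, LinearMap.zero_apply]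
  have he' : ∀ r d, N ≤ d → e r d = 0 := by
    intro r d hd
    by_cases hr : r < C
    · exact hD _ _ (by omega) (by omega)
    · simp only [he_def]
      rw [hC _ (by omega), ← modeₗ_apply, map_zero, LinearMap.zero_apply]
  have key := sum_choose_smul_eq_sum_choose_smul (p + a) (q + b) s N e he he'
  have hL : ∀ i : ℕ, 𝒱.wres (a + b + 1 + i - l) (s + t + i) (𝒱.wres a (l - i) u v) w =
      ∑ j ∈ Finset.range N, ∑ k ∈ Finset.range N,
        (Ring.choose (p + a) j * Ring.choose (p + a + (q + b) - j) k) • e (i + j) (k + j) := by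
    intro i
    rw [𝒱.wres_eq_sum_range a (l - i) hu v N (fun j hj => hC _ (by omega)), map_sum,
      LinearMap.sum_apply]
    refine Finset.sum_congr rfl fun j _ => ?_
    have hm := 𝒱.mode_mem_weightSpace hu hv (j - (l - i))
    have hidx : ∀ k : ℕ, 𝒱.mode (𝒱.mode u (j - (l - i)) v) (k - (s + t + i)) w =
        e (i + j) (k + j) := by
      intro k
      simp only [he_def]
      rw [show (j : ℤ) - (l - i) = -l + ((i + j : ℕ) : ℤ) by push_cast; ring,
        show (k : ℤ) - (s + t + i) = ((k + j : ℕ) : ℤ) - s - t - ((i + j : ℕ) : ℤ) by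
          push_cast; ring]
    rw [map_zsmul, LinearMap.smul_apply, 𝒱.wres_eq_sum_range _ _ hm w N (fun k hk => by
      rw [hidx]; exact he' _ _ (by omega)), Finset.smul_sum]
    refine Finset.sum_congr rfl fun k _ => ?_
    rw [smul_smul, hidx]
    congr 3
    ring
  simp only [hL, Finset.smul_sum, smul_smul, ← mul_assoc]
  rw [← key]
  refine Finset.sum_congr rfl fun m _ => Finset.sum_congr rfl fun j _ =>
    Finset.sum_congr rfl fun i _ => ?_
  simp only [he_def]
  congr 3
  push_cast; ring

/-- The Jacobi identity for weighted residues. -/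
theorem eventually_wres_jacobi (a b l s t : ℤ) (u v w : V) :
    ∀ᶠ N : ℕ in atTop, ∑ i ∈ Finset.range N, Ring.choose (-s) i •
        𝒱.wres (a + b + 1 + i - l) (s + t + i) (𝒱.wres a (l - i) u v) w =
      ∑ i ∈ Finset.range N, ((-1) ^ i * Ring.choose (-l) i : ℤ) •
        𝒱.wres a (s + l + i) u (𝒱.wres b (t - i) v w) -
      ((-1 : ℂ) ^ (-l)) • ∑ i ∈ Finset.range N, ((-1) ^ i * Ring.choose (-l) i : ℤ) •
        𝒱.wres b (l + t + i) v (𝒱.wres a (s - i) u w) := by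
  induction u using 𝒱.homogeneous_induction with
  | hadd u u' h h' =>
    filter_upwards [h, h'] with N h h'
    simp only [map_add, LinearMap.add_apply, smul_add, Finset.sum_add_distrib, h, h']
    abel
  | hom p u hu =>
    induction v using 𝒱.homogeneous_induction with
    | hadd v v' h h' =>
      filter_upwards [h, h'] with N h h'
      simp only [map_add, LinearMap.add_apply, smul_add, Finset.sum_add_distrib, h, h']
      abel
    | hom q v hv =>
      obtain ⟨C1, h1⟩ := 𝒱.exists_nat_mode_eq_zero u v l
      obtain ⟨C2, h2⟩ := 𝒱.exists_nat_mode_eq_zero v w t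
      obtain ⟨C3, h3⟩ := 𝒱.exists_nat_mode_eq_zero u w s
      -- Each expansion is valid for all large `N`, so one `N` serves all of them. The identity is
      -- then the componentwise Jacobi identity at `(-l, m - s, j - t)`, weighted by `C(p+a,m)
      -- C(q+b,j)` and summed.
      filter_upwards [𝒱.eventually_wres_iterate_eq_sum a b l s t hu hv w,
        𝒱.eventually_wres_wres_eq_sum a b (-l) (s + l) t hu hv w,
        𝒱.eventually_wres_wres_eq_sum b a (-l) (l + t) s hv hu w,
        eventually_ge_atTop (C1 + C2 + C3)] with N e1 e2 e3 hN
      rw [e1, e2, e3, Finset.sum_comm (s := Finset.range N) (t := Finset.range N)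
        (f := fun m j => (Ring.choose (q + b) m * Ring.choose (p + a) j) • _)]
      rw [Finset.smul_sum, ← Finset.sum_sub_distrib]
      refine Finset.sum_congr rfl fun m _ => ?_
      rw [Finset.smul_sum, ← Finset.sum_sub_distrib]
      refine Finset.sum_congr rfl fun j _ => ?_
      rw [𝒱.jacobi_mode u v w (-l) (m - s) (j - t) N (fun i hi => h1 _ (by omega))
        (fun i hi => h2 _ (by omega)) (fun i hi => h3 _ (by omega)), smul_sub]
      congr 1
      · congr 1
        refine Finset.sum_congr rfl fun i _ => ?_
        rw [show (m : ℤ) - s + -l - i = m - (s + l) - i by ring]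
      · rw [smul_comm, mul_comm]
        congr 2
        refine Finset.sum_congr rfl fun i _ => ?_
        rw [show -l + ((j : ℤ) - t) - i = j - (l + t) - i by ring]


/-! ### The operator `L(-1) + L(0)` and residues lying in `O_n(V)`. -/

theorem L_neg_one_mem_weightSpace {k : ℤ} {u : V} (hu : u ∈ 𝒱.weightSpace k) :
    𝒱.L (-1) u ∈ 𝒱.weightSpace (k + 1) := by
  have h := 𝒱.mode_mem_weightSpace 𝒱.conformal_mem hu 0
  rwa [show 2 + k - 0 - 1 = k + 1 by ring] at h

/-- Integration by parts: the residue of the derivative of `(1+x)^(wt u + a + 1) x^(-s) Y(u,x)v` is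
zero. The exponent matches since `L(-1)u` has weight `wt u + 1`, and `L(0)u` cancels the dependence
on `wt u`. -/
theorem wres_L_neg_one_add_L_zero (a s : ℤ) (u v : V) :
    𝒱.wres a s (𝒱.L (-1) u + 𝒱.L 0 u) v =
      (s - a - 1) • 𝒱.wres a s u v + s • 𝒱.wres a (s + 1) u v := by
  induction u using 𝒱.homogeneous_induction with
  | hadd u u' h h' =>
    have : 𝒱.L (-1) (u + u') + 𝒱.L 0 (u + u') =
      (𝒱.L (-1) u + 𝒱.L 0 u) + (𝒱.L (-1) u' + 𝒱.L 0 u') := by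
      simp only [map_add]; abel
    rw [this, map_add, LinearMap.add_apply, h, h', map_add, map_add, LinearMap.add_apply,
      LinearMap.add_apply, smul_add, smul_add]
    abel
  | hom k u hu =>
    obtain ⟨N, hN⟩ := 𝒱.exists_nat_mode_eq_zero u v (s + 1)
    rw [map_add, LinearMap.add_apply, 𝒱.L_zero_apply hu, map_smul, LinearMap.smul_apply,
      𝒱.wres_eq_sum_range a s (𝒱.L_neg_one_mem_weightSpace hu) v (N + 1) (fun i hi => by
        rw [mode_L_neg_one, LinearMap.smul_apply, hN _ (by omega), smul_zero]),
      𝒱.wres_eq_sum_range a s hu v N (fun i hi => hN _ (by omega)),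
      𝒱.wres_eq_sum_range a (s + 1) hu v (N + 1) (fun i hi => hN _ (by omega)),
      Finset.sum_range_succ', Finset.sum_range_succ' _ N, Int.cast_smul_eq_zsmul]
    simp only [Ring.choose_zero_right, mode_L_neg_one, one_smul, LinearMap.smul_apply,
      smul_add, Finset.smul_sum]
    rw [add_right_comm, ← add_assoc, ← Finset.sum_add_distrib, ← Finset.sum_add_distrib]
    congr 1
    · refine Finset.sum_congr rfl fun i _ => ?_
      have h2 := Ring.choose_smul_choose (k + a) (n := i + 1) (k := i) (by omega)
      rw [Nat.choose_succ_self_right, add_tsub_cancel_left, Ring.choose_one_right,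
        nsmul_eq_mul] at h2
      rw [show k + 1 + a = k + a + 1 by ring, Ring.choose_succ_succ,
        show ((i + 1 : ℕ) : ℤ) - s - 1 = i - s by push_cast; ring,
        show ((i + 1 : ℕ) : ℤ) - (s + 1) = i - s by push_cast; ring,
        ← Int.cast_neg, Int.cast_smul_eq_zsmul]
      simp only [smul_smul, ← add_smul]
      congr 1
      push_cast at h2 ⊢
      linear_combination -h2
    · rw [← Int.cast_neg, Int.cast_smul_eq_zsmul, sub_sub]
      congr 1
      push_cast; ring

theorem L_neg_one_add_L_zero_mem (n : ℕ) (u : V) : 𝒱.L (-1) u + 𝒱.L 0 u ∈ 𝒱.O n :=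
  Submodule.subset_span (Or.inr ⟨u, rfl⟩)

theorem zsmul_mem_O_iff (n : ℕ) {s : ℤ} (hs : s ≠ 0) {x : V} : s • x ∈ 𝒱.O n ↔ x ∈ 𝒱.O n := by
  rw [← Int.cast_smul_eq_zsmul ℂ]
  exact Submodule.smul_mem_iff _ (by exact_mod_cast hs)

/-- For `a = n` the pole order climbs from `2n+2`: integration by parts expresses `s • wres n (s+1)
u v` through residues with pole order `s`, and `s ≠ 0` can be divided out. Pascal's rule then raises
`a`, at the cost of one pole order per step. -/
theorem wres_mem_O (n : ℕ) (a s : ℤ) (ha : n ≤ a) (hs : a + n + 2 ≤ s) (u v : V) :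
    𝒱.wres a s u v ∈ 𝒱.O n := by
  have h1 : ∀ (m : ℕ) (u v : V), 𝒱.wres n (2 * n + 2 + m) u v ∈ 𝒱.O n := by
    intro m
    induction m with
    | zero =>
      intro u v
      induction u using 𝒱.homogeneous_induction with
      | hadd u u' h h' =>
        rw [map_add, LinearMap.add_apply]
        exact add_mem h h'
      | hom k u hu =>
        refine Submodule.subset_span (Or.inl ⟨k, u, v, hu, ?_⟩)
        rw [circ, 𝒱.wres_of_mem _ _ hu, Nat.cast_zero, add_zero]
    | succ m ih =>
      intro u v
      rw [← 𝒱.zsmul_mem_O_iff n (s := 2 * n + 2 + m) (by omega)]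
      have h := 𝒱.wres_L_neg_one_add_L_zero n (2 * n + 2 + m) u v
      rw [Nat.cast_succ, ← add_assoc, ← sub_eq_iff_eq_add'.2 h]
      exact sub_mem (ih _ _) (zsmul_mem (ih _ _) _)
  have h2 : ∀ (k m : ℕ), k ≤ m → 𝒱.wres (n + k) (2 * n + 2 + m) u v ∈ 𝒱.O n := by
    intro k
    induction k with
    | zero =>
      intro m _
      rw [Nat.cast_zero, add_zero]
      exact h1 m u v
    | succ k ih =>
      intro m hm
      obtain ⟨m, rfl⟩ := Nat.exists_eq_add_of_le' (show 1 ≤ m by omega)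
      rw [Nat.cast_succ, Nat.cast_succ, ← add_assoc, ← add_assoc, wres_succ, add_assoc _ (m : ℤ)]
      refine add_mem ?_ (ih m (by omega))
      exact_mod_cast ih (m + 1) (by omega)
  have h3 := h2 (a - n).toNat (s - (2 * n + 2)).toNat (by omega)
  rwa [show (n : ℤ) + (a - n).toNat = a by omega,
    show 2 * (n : ℤ) + 2 + (s - (2 * n + 2)).toNat = s by omega] at h3

theorem sum_range_choose_zero_smul {M : Type*} [AddCommGroup M] {N : ℕ} (hN : 1 ≤ N) (f : ℕ → M) :
    ∑ i ∈ Finset.range N, Ring.choose (0 : ℤ) i • f i = f 0 := by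
  obtain ⟨N, rfl⟩ := Nat.exists_eq_add_of_le' hN
  rw [Finset.sum_range_succ']
  simp [Ring.choose_zero_succ]

theorem sum_range_neg_one_pow_choose_zero_smul {M : Type*} [AddCommGroup M] {N : ℕ} (hN : 1 ≤ N)
    (f : ℕ → M) :
    ∑ i ∈ Finset.range N, ((-1) ^ i * Ring.choose (0 : ℤ) i) • f i = f 0 := by
  obtain ⟨N, rfl⟩ := Nat.exists_eq_add_of_le' hN
  rw [Finset.sum_range_succ']
  simp [Ring.choose_zero_succ]

/-- The commutator formula for weighted residues. -/
theorem eventually_wres_comm (a b s t : ℤ) (u v w : V) :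
    ∀ᶠ N : ℕ in atTop, 𝒱.wres a s u (𝒱.wres b t v w) - 𝒱.wres b t v (𝒱.wres a s u w) =
      ∑ i ∈ Finset.range N, Ring.choose (-s) i •
        𝒱.wres (a + b + 1 + i) (s + t + i) (𝒱.wres a (-i) u v) w := by
  filter_upwards [𝒱.eventually_wres_jacobi a b 0 s t u v w, eventually_ge_atTop 1] with N h hN
  rw [neg_zero, sum_range_neg_one_pow_choose_zero_smul hN,
    sum_range_neg_one_pow_choose_zero_smul hN] at h
  simpa using h.symm

/-- Since `ω` has weight 2, this is the residue of `(1+x) Y(ω,x) w`. In this form the commutator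
formula at `s = 0` makes `L(-1) + L(0)` a derivation of every `wres b t`. -/
theorem wres_conformal (w : V) :
    𝒱.wres (-1) 0 𝒱.conformal w = 𝒱.L (-1) w + 𝒱.L 0 w := by
  obtain ⟨N, hN⟩ := 𝒱.exists_nat_mode_eq_zero 𝒱.conformal w 0
  rw [𝒱.wres_eq_sum_range _ _ 𝒱.conformal_mem w (N + 2) (fun i hi => hN _ (by omega)),
    Finset.sum_range_succ', Finset.sum_range_succ', Finset.sum_eq_zero]
  · simp only [L]
    norm_num
    exact add_comm _ _
  · intro i _
    have := Ring.choose_natCast (R := ℤ) 1 (i + 1 + 1)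
    rw [Nat.cast_one] at this
    rw [show (2 : ℤ) + -1 = 1 by norm_num, this, Nat.choose_eq_zero_of_lt (by omega),
      Nat.cast_zero, zero_smul]

theorem L_neg_one_add_L_zero_wres (b t : ℤ) (v w : V) :
    𝒱.L (-1) (𝒱.wres b t v w) + 𝒱.L 0 (𝒱.wres b t v w) =
      𝒱.wres b t (𝒱.L (-1) v + 𝒱.L 0 v) w + 𝒱.wres b t v (𝒱.L (-1) w + 𝒱.L 0 w) := by
  obtain ⟨N, h, hN⟩ := ((𝒱.eventually_wres_comm (-1) b 0 t 𝒱.conformal v w).and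
    (eventually_ge_atTop 1)).exists
  rw [neg_zero, sum_range_choose_zero_smul hN] at h
  simp only [Nat.cast_zero, neg_zero, wres_conformal, add_zero, zero_add] at h
  rw [sub_eq_iff_eq_add] at h
  rw [h, show -1 + b + 1 = b by ring]

/-! ### `O_n(V)` is a two-sided ideal for `*_n`. -/

theorem star_L_neg_one_add_L_zero_mem (n : ℕ) (u v : V) :
    𝒱.star n (𝒱.L (-1) u + 𝒱.L 0 u) v ∈ 𝒱.O n := by
  -- The sum telescopes after integration by parts. At `N = n + 1` the single remaining residue has
  -- pole order `2n + 2`, hence lies in `O_n(V)`.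
  have key : ∀ N : ℕ, ∑ m ∈ Finset.range N, ((-1) ^ m * ((m + n).choose n : ℤ) : ℤ) •
      𝒱.wres n (n + m + 1) (𝒱.L (-1) u + 𝒱.L 0 u) v =
      (-((-1) ^ N * (N * (N + n).choose n)) : ℤ) • 𝒱.wres n (n + N + 1) u v := by
    intro N
    induction N with
    | zero => simp
    | succ N ih =>
      rw [Finset.sum_range_succ, ih, wres_L_neg_one_add_L_zero, smul_add, smul_smul, smul_smul,
        ← add_assoc, ← add_smul]
      have h1 : (N + 1) * (N + 1 + n).choose n = (N + n).choose n * (n + N + 1) := by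
        have h := Nat.add_one_mul_choose_eq (N + n) N
        have h2 : (N + 1 + n).choose n = (N + n + 1).choose (N + 1) := by
          rw [Nat.add_right_comm N 1 n]
          exact Nat.choose_symm_of_eq_add (by omega)
        have h3 : (N + n).choose n = (N + n).choose N := Nat.choose_symm_of_eq_add (by omega)
        rw [h2, h3]
        linarith
      have h1' : ((N : ℤ) + 1) * (N + 1 + n).choose n = (N + n).choose n * (n + N + 1) := by
        exact_mod_cast h1
      have h0 : (-((-1) ^ N * (N * (N + n).choose n)) +
          (-1) ^ N * (N + n).choose n * ((n : ℤ) + N + 1 - n - 1) : ℤ) = 0 := by ring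
      rw [h0, zero_smul, zero_add,
        show (n : ℤ) + (N + 1 : ℕ) + 1 = n + N + 1 + 1 by push_cast; ring]
      congr 1
      push_cast
      linear_combination (-(-1) ^ N) * h1'
  rw [star_eq_sum_wres, key]
  refine zsmul_mem (𝒱.wres_mem_O n _ _ le_rfl ?_ _ _) _
  push_cast
  linarith

theorem star_wres_mem (n : ℕ) (u v w : V) :
    𝒱.star n (𝒱.wres n (2 * n + 2) u v) w ∈ 𝒱.O n := by
  rw [star_eq_sum_wres]
  refine sum_mem fun m _ => zsmul_mem ?_ _
  -- With `s = 0` the left side is one iterate, and `b = 2n + 1` makes its outer weight shift `n`.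
  -- Every term on the right has an outer pole large enough for `wres_mem_O`.
  obtain ⟨N, h, hN⟩ := ((𝒱.eventually_wres_jacobi n (2 * n + 1) (2 * n + 2) 0 (n + m + 1) u v w).and
    (eventually_ge_atTop 1)).exists
  rw [neg_zero, sum_range_choose_zero_smul hN] at h
  simp only [Nat.cast_zero, sub_zero, zero_add, add_zero] at h
  rw [show (n : ℤ) + (2 * n + 1) + 1 - (2 * n + 2) = n by ring] at h
  rw [h]
  refine sub_mem (sum_mem fun i _ => zsmul_mem (𝒱.wres_mem_O n _ _ ?_ ?_ _ _) _)
    (Submodule.smul_mem _ _ (sum_mem fun i _ => zsmul_mem (𝒱.wres_mem_O n _ _ ?_ ?_ _ _) _))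
  all_goals omega

theorem star_mem_of_left_mem (n : ℕ) {x : V} (hx : x ∈ 𝒱.O n) (w : V) : 𝒱.star n x w ∈ 𝒱.O n := by
  induction hx using Submodule.span_induction with
  | zero => simp
  | add x y _ _ hx hy => rw [map_add, LinearMap.add_apply]; exact add_mem hx hy
  | smul c x _ hx => rw [map_smul, LinearMap.smul_apply]; exact Submodule.smul_mem _ _ hx
  | mem x hx =>
    rcases hx with ⟨k, u, v, hu, rfl⟩ | ⟨v, rfl⟩
    · rw [circ, ← 𝒱.wres_of_mem _ _ hu]
      exact 𝒱.star_wres_mem n u v w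
    · exact 𝒱.star_L_neg_one_add_L_zero_mem n v w

theorem star_mem_of_right_mem (n : ℕ) (w : V) {x : V} (hx : x ∈ 𝒱.O n) : 𝒱.star n w x ∈ 𝒱.O n := by
  induction hx using Submodule.span_induction with
  | zero => simp
  | add x y _ _ hx hy => rw [map_add]; exact add_mem hx hy
  | smul c x _ hx => rw [map_smul]; exact Submodule.smul_mem _ _ hx
  | mem x hx =>
    rcases hx with ⟨k, u, v, hu, rfl⟩ | ⟨v, rfl⟩
    · rw [circ, ← 𝒱.wres_of_mem _ _ hu, star_eq_sum_wres]
      refine sum_mem fun m _ => zsmul_mem ?_ _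
      -- Commuting moves the pole of order `2n + 2` to the outside; in the commutator terms the two
      -- pole orders add up.
      obtain ⟨N, h⟩ := (𝒱.eventually_wres_comm n n (n + m + 1) (2 * n + 2) w u v).exists
      rw [sub_eq_iff_eq_add] at h
      rw [h]
      refine add_mem (sum_mem fun i _ => zsmul_mem (𝒱.wres_mem_O n _ _ ?_ ?_ _ _) _)
        (𝒱.wres_mem_O n _ _ ?_ ?_ _ _)
      all_goals omega
    -- The derivation property reduces this case to the one with `L(-1) + L(0)` in the left factor.
    · have h : 𝒱.star n w (𝒱.L (-1) v + 𝒱.L 0 v) = (𝒱.L (-1) (𝒱.star n w v) +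
          𝒱.L 0 (𝒱.star n w v)) - 𝒱.star n (𝒱.L (-1) w + 𝒱.L 0 w) v := by
        simp only [star_eq_sum_wres, map_sum, map_zsmul]
        rw [← Finset.sum_add_distrib, ← Finset.sum_sub_distrib]
        refine Finset.sum_congr rfl fun m _ => ?_
        rw [← smul_add, L_neg_one_add_L_zero_wres, smul_add, add_sub_cancel_left]
      rw [h]
      exact sub_mem (𝒱.L_neg_one_add_L_zero_mem n _) (𝒱.star_L_neg_one_add_L_zero_mem n _ _)

/-! ### Comparison of consecutive levels. -/

theorem O_succ_le (n : ℕ) : 𝒱.O (n + 1) ≤ 𝒱.O n := by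
  refine Submodule.span_le.2 ?_
  rintro _ (⟨k, u, v, hu, rfl⟩ | ⟨v, rfl⟩)
  · rw [circ, ← 𝒱.wres_of_mem _ _ hu]
    refine 𝒱.wres_mem_O n _ _ ?_ ?_ _ _ <;> push_cast <;> omega
  · exact 𝒱.L_neg_one_add_L_zero_mem n v

/-- Splitting every term of `*_{n+1}` by `wres_succ` and collecting equal pole orders, Pascal's rule
for the coefficients gives back `*_n`. Two boundary terms remain, with pole orders `2n+2` and
`2n+3`, both in `O_n(V)`. -/
theorem star_succ_sub_star_mem (n : ℕ) (u v : V) :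
    𝒱.star (n + 1) u v - 𝒱.star n u v ∈ 𝒱.O n := by
  have h : 𝒱.star (n + 1) u v - 𝒱.star n u v =
      ((-1) ^ (n + 1) * ((n + 1 + n).choose n : ℤ) : ℤ) • 𝒱.wres n (n + (n + 1 : ℕ) + 1) u v +
      ((-1) ^ (n + 1) * ((n + 1 + (n + 1)).choose (n + 1) : ℤ) : ℤ) •
        𝒱.wres n (n + (n + 1 + 1 : ℕ) + 1) u v := by
    rw [sub_eq_iff_eq_add, add_right_comm, add_comm (_ • _) (𝒱.star n u v)]
    simp only [star_eq_sum_wres]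
    rw [← Finset.sum_range_succ (fun m : ℕ => ((-1) ^ m * ((m + n).choose n : ℤ) : ℤ) •
      𝒱.wres n (n + m + 1) u v)]
    have h1 : ∀ m : ℕ, 𝒱.wres ((n + 1 : ℕ) : ℤ) ((n + 1 : ℕ) + m + 1) u v =
        𝒱.wres n (n + (m + 1 : ℕ) + 1) u v + 𝒱.wres n (n + m + 1) u v := by
      intro m
      rw [show (((n + 1 : ℕ) : ℤ) + m + 1) = (n + m + 1) + 1 by push_cast; ring, Nat.cast_succ,
        wres_succ, show (n : ℤ) + (m + 1 : ℕ) + 1 = n + m + 1 + 1 by push_cast; ring]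
    simp only [h1, smul_add, Finset.sum_add_distrib]
    rw [Finset.sum_range_succ (fun m : ℕ => ((-1) ^ m * ((m + (n + 1)).choose (n + 1) : ℤ) : ℤ) •
      𝒱.wres n (n + (m + 1 : ℕ) + 1) u v),
      Finset.sum_range_succ' (fun m : ℕ => ((-1) ^ m * ((m + (n + 1)).choose (n + 1) : ℤ) : ℤ) •
      𝒱.wres n (n + m + 1) u v), Finset.sum_range_succ' _ (n + 1),
      add_right_comm, ← add_assoc, ← Finset.sum_add_distrib]
    congr 2
    · refine Finset.sum_congr rfl fun m _ => ?_
      rw [← add_smul]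
      congr 1
      have := Nat.choose_succ_succ (m + 1 + n) n
      rw [show m + 1 + (n + 1) = (m + 1 + n) + 1 by ring, show m + (n + 1) = m + 1 + n by ring]
      simp only [Nat.succ_eq_add_one] at this
      rw [this]
      push_cast
      ring
    · simp
  rw [h]
  refine add_mem (zsmul_mem (𝒱.wres_mem_O n _ _ ?_ ?_ _ _) _)
    (zsmul_mem (𝒱.wres_mem_O n _ _ ?_ ?_ _ _) _) <;> push_cast <;> omega

/-! ### Associativity. -/

theorem neg_one_pow_mul_choose_neg (n m i : ℕ) :
    (-1) ^ i * Ring.choose (-((n : ℤ) + m + 1)) i = ((n + m + i).choose i : ℤ) := by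
  rw [Ring.choose_neg, Int.negOnePow_def]
  rw [show (n : ℤ) + m + 1 + i - 1 = ((n + m + i : ℕ) : ℤ) by push_cast; ring, Ring.choose_natCast]
  simp [Units.smul_def, ← mul_assoc, ← mul_pow]

/-- Jacobi at `l = n + m + 1`, `s = 0`, with `b = n + m` chosen so that the iterate has weight shift
`n`. The terms `i ≥ n + 1 - m` have outer pole order at least `2n + 2`; the terms with `v` outside
lie in `O_n(V)` because `t ≥ n + 1`. -/
theorem wres_wres_sub_sum_mem (n m : ℕ) (hm : m ≤ n) (t : ℤ) (ht : n + 1 ≤ t) (u v w : V) :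
    𝒱.wres n t (𝒱.wres n (n + m + 1) u v) w - ∑ i ∈ Finset.range (n + 1 - m),
      ((n + m + i).choose i : ℤ) • 𝒱.wres n (n + m + 1 + i) u (𝒱.wres (n + m) (t - i) v w) ∈
      𝒱.O n := by
  obtain ⟨N, h, hN⟩ := ((𝒱.eventually_wres_jacobi n (n + m) (n + m + 1) 0 t u v w).and
    (eventually_ge_atTop (n + 1))).exists
  rw [neg_zero, sum_range_choose_zero_smul (by omega)] at h
  simp only [Nat.cast_zero, sub_zero, zero_add, add_zero, neg_one_pow_mul_choose_neg] at h
  rw [show (n : ℤ) + (n + m) + 1 - (n + m + 1) = n by ring] at h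
  rw [h, sub_right_comm, ← Finset.sum_range_add_sum_Ico _ (show n + 1 - m ≤ N by omega),
    add_sub_cancel_left]
  refine sub_mem (sum_mem fun i hi => zsmul_mem (𝒱.wres_mem_O n _ _ ?_ ?_ _ _) _)
    (Submodule.smul_mem _ _ (sum_mem fun i _ => zsmul_mem (𝒱.wres_mem_O n _ _ ?_ ?_ _ _) _))
  · omega
  · have := (Finset.mem_Ico.1 hi).1
    omega
  · omega
  · omega

/-- Grouping the main terms of `wres_wres_sub_sum_mem` by `r = m + i`, the outer residue depends
only on `r`, and the inner ones combine by the alternating Pascal sum into `(-1)^r wres n t v w`.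
The coefficients match by `C(r+n,n) C(r,m) = C(m+n,n) C(n+r,i)`. Associativity uses the values of
`t` that occur in `v *_n w`. -/
theorem wres_star_sub_star_wres_mem (n : ℕ) (t : ℤ) (ht : n + 1 ≤ t) (u v w : V) :
    𝒱.wres n t (𝒱.star n u v) w - 𝒱.star n u (𝒱.wres n t v w) ∈ 𝒱.O n := by
  have h : 𝒱.star n u (𝒱.wres n t v w) = ∑ m ∈ Finset.range (n + 1),
      ((-1) ^ m * ((m + n).choose n : ℤ) : ℤ) • ∑ i ∈ Finset.range (n + 1 - m),
      ((n + m + i).choose i : ℤ) • 𝒱.wres n (n + m + 1 + i) u (𝒱.wres (n + m) (t - i) v w) := by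
    have h1 := Finset.sum_range_diag_flip (n + 1) fun m i : ℕ =>
      ((-1) ^ m * ((m + n).choose n : ℤ) : ℤ) • ((n + m + i).choose i : ℤ) •
        𝒱.wres n (n + m + 1 + i) u (𝒱.wres (n + m) (t - i) v w)
    simp only [Finset.smul_sum]
    rw [← h1, star_eq_sum_wres]
    refine Finset.sum_congr rfl fun r _ => ?_
    have h2 := sum_neg_one_pow_choose_smul_of_pascal (fun a s => 𝒱.wres a s v w)
      (fun a s => 𝒱.wres_succ a s v w) r n (t - r)
    simp only [sub_add_cancel] at h2
    have h3 : 𝒱.wres n t v w = (-1 : ℤ) ^ r • (-1 : ℤ) ^ r • 𝒱.wres n t v w := by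
      rw [smul_smul, ← mul_pow]
      simp
    rw [h3, ← h2, map_zsmul, map_sum, smul_smul, Finset.smul_sum]
    refine Finset.sum_congr rfl fun m hm => ?_
    have hmr : m ≤ r := Nat.lt_succ_iff.1 (Finset.mem_range.1 hm)
    obtain ⟨i, rfl⟩ := Nat.exists_eq_add_of_le hmr
    rw [map_zsmul, smul_smul, smul_smul, add_tsub_cancel_left]
    rw [show (n : ℤ) + m + 1 + i = n + (m + i : ℕ) + 1 by push_cast; ring,
      show t - (m + i : ℕ) + m = t - i by push_cast; ring]
    congr 1
    have h4 : (m + i + n).choose n * (m + i).choose m =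
        (m + n).choose n * (n + m + i).choose i := by
      have h5 := Nat.choose_mul (n := m + i + n) (k := m + n) (s := n) (by omega)
      rw [show m + i + n - n = m + i by omega, show m + n - n = m by omega] at h5
      rw [← h5, mul_comm, show n + m + i = m + i + n by ring]
      congr 1
      exact Nat.choose_symm_of_eq_add (by omega)
    have h4' : ((m + i + n).choose n : ℤ) * (m + i).choose m =
        (m + n).choose n * (n + m + i).choose i := by exact_mod_cast h4
    have h6 : ((-1 : ℤ) ^ (m + i)) * (-1) ^ (m + i) = 1 := by
      rw [← mul_pow]; simp
    linear_combination ((-1) ^ m : ℤ) * h4' +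
      ((m + i + n).choose n * (-1) ^ m * (m + i).choose m : ℤ) * h6
  rw [h, star_eq_sum_wres, map_sum, LinearMap.sum_apply, ← Finset.sum_sub_distrib]
  refine sum_mem fun m hm => ?_
  rw [map_zsmul, LinearMap.smul_apply, ← smul_sub]
  exact zsmul_mem (𝒱.wres_wres_sub_sum_mem n m
    (Nat.lt_succ_iff.1 (Finset.mem_range.1 hm)) t ht u v w) _

theorem star_star_sub_star_star_mem (n : ℕ) (u v w : V) :
    𝒱.star n (𝒱.star n u v) w - 𝒱.star n u (𝒱.star n v w) ∈ 𝒱.O n := by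
  rw [𝒱.star_eq_sum_wres n _ w, 𝒱.star_eq_sum_wres n v w, map_sum, ← Finset.sum_sub_distrib]
  refine sum_mem fun m _ => ?_
  rw [map_zsmul, ← smul_sub]
  exact zsmul_mem (𝒱.wres_star_sub_star_wres_mem n _ (by omega) u v w) _

/-! ### The unit. -/

theorem sum_neg_one_pow_choose_mul_choose_smul {M : Type*} [AddCommGroup M] (n : ℕ) (v : M) :
    ∑ m ∈ Finset.range (n + 1), ((-1) ^ m * ((m + n).choose n : ℤ) : ℤ) •
      Ring.choose (n : ℤ) (n + m) • v = v := by
  rw [Finset.sum_range_succ', Finset.sum_eq_zero]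
  · simp [Ring.choose_natCast]
  · intro m _
    rw [Ring.choose_natCast, Nat.choose_eq_zero_of_lt (show n < n + (m + 1) by omega), Nat.cast_zero,
      zero_smul, smul_zero]

theorem wres_vacuum_left (a : ℤ) (s : ℕ) (v : V) :
    𝒱.wres a (s + 1) 𝒱.vacuum v = Ring.choose a s • v := by
  have h : ∀ k : ℤ, 𝒱.mode 𝒱.vacuum k v = if k = -1 then v else 0 := fun k => 𝒱.vacuum_mode k v
  rw [𝒱.wres_eq_sum_range _ _ 𝒱.vacuum_mem v (s + 1) (fun i hi => by
    rw [h, if_neg (by omega)]), Finset.sum_eq_single_of_mem s (by simp)]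
  · rw [h, if_pos (by omega), zero_add]
  · intro i _ hi
    rw [h, if_neg (by omega), smul_zero]

theorem star_vacuum_left (n : ℕ) (v : V) : 𝒱.star n 𝒱.vacuum v = v := by
  rw [star_eq_sum_wres]
  refine Eq.trans (Finset.sum_congr rfl fun m _ => ?_)
    (sum_neg_one_pow_choose_mul_choose_smul n v)
  rw [← wres_vacuum_left, Nat.cast_add]

/-- One has `v_{-1-j} 𝟏 = L(-1)^j v / j!`, and modulo `O_n(V)` the operator `L(-1)` acts on weight
`k` as `-k`, then on weight `k+1` as `-(k+1)`, and so on; the product over `j!` is `C(-k,j)`. -/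
theorem mode_vacuum_sub_mem (n j : ℕ) {k : ℤ} {v : V} (hv : v ∈ 𝒱.weightSpace k) :
    𝒱.mode v (-1 - j) 𝒱.vacuum - Ring.choose (-k) j • v ∈ 𝒱.O n := by
  induction j generalizing k v with
  | zero =>
    have : 𝒱.mode v (-1) 𝒱.vacuum = v := 𝒱.creation v
    simp [this]
  | succ j ih =>
    have h1 := ih (𝒱.L_neg_one_mem_weightSpace hv)
    have h2 := 𝒱.L_neg_one_add_L_zero_mem n v
    rw [𝒱.L_zero_apply hv, Int.cast_smul_eq_zsmul] at h2
    rw [mode_L_neg_one, LinearMap.smul_apply, ← Int.cast_neg, Int.cast_smul_eq_zsmul] at h1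
    have h3 := Ring.choose_smul_choose (-k) (n := j + 1) (k := 1) (by omega)
    rw [Nat.choose_one_right, Ring.choose_one_right, nsmul_eq_mul, add_tsub_cancel_right] at h3
    rw [← 𝒱.zsmul_mem_O_iff n (s := (j + 1 : ℕ)) (by omega)]
    have h4 := add_mem h1 (zsmul_mem h2 (Ring.choose (-(k + 1)) j))
    convert h4 using 1
    rw [smul_sub, smul_smul, h3, smul_add, smul_smul,
      show -1 - ((j + 1 : ℕ) : ℤ) = -1 - j - 1 by push_cast; ring,
      show -(k + 1) = -k - (1 : ℕ) by push_cast; ring,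
      show -(-1 - (j : ℤ)) = (j + 1 : ℕ) by push_cast; ring, mul_comm, mul_neg, neg_smul]
    abel

/-- Vandermonde for `(k+a) + (-k)` cancels the weight, leaving the same coefficient as with the
vacuum on the left. -/
theorem wres_vacuum_right_sub_mem (n : ℕ) (a : ℤ) (s : ℕ) (v : V) :
    𝒱.wres a (s + 1) v 𝒱.vacuum - Ring.choose a s • v ∈ 𝒱.O n := by
  induction v using 𝒱.homogeneous_induction with
  | hadd v v' h h' =>
    have := add_mem h h'
    rwa [sub_add_sub_comm, ← smul_add, ← LinearMap.add_apply, ← map_add] at this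
  | hom k v hv =>
    rw [𝒱.wres_eq_sum_range _ _ hv 𝒱.vacuum (s + 1) (fun i hi =>
      𝒱.creation_of_nonneg v _ (by omega)), show a = (k + a) + -k by ring,
      Ring.add_choose_eq s (Commute.all _ _), Finset.Nat.sum_antidiagonal_eq_sum_range_succ_mk,
      Finset.sum_smul, ← Finset.sum_sub_distrib]
    refine sum_mem fun i hi => ?_
    have hi' : i ≤ s := Nat.lt_succ_iff.1 (Finset.mem_range.1 hi)
    rw [show k + (k + a + -k) = k + a by ring, mul_smul, ← smul_sub,
      show (i : ℤ) - (s + 1) = -1 - (s - i : ℕ) by omega]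
    exact zsmul_mem (𝒱.mode_vacuum_sub_mem n _ hv) _

theorem star_vacuum_right_sub_mem (n : ℕ) (v : V) : 𝒱.star n v 𝒱.vacuum - v ∈ 𝒱.O n := by
  have h := sum_neg_one_pow_choose_mul_choose_smul n v
  rw [show 𝒱.star n v 𝒱.vacuum - v = 𝒱.star n v 𝒱.vacuum - _ from congrArg _ h.symm,
    star_eq_sum_wres, ← Finset.sum_sub_distrib]
  refine sum_mem fun m _ => ?_
  rw [← smul_sub]
  have := 𝒱.wres_vacuum_right_sub_mem n n (n + m) v
  rw [Nat.cast_add] at this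
  exact zsmul_mem this _

/-! ### The algebra `A_n(V)` and its presentations. -/

/-- The product of the level `n` Zhu algebra. -/
def zhuMul (n : ℕ) : 𝒱.Zhu n →ₗ[ℂ] 𝒱.Zhu n →ₗ[ℂ] 𝒱.Zhu n :=
  (𝒱.O n).liftQ
    { toFun u := (𝒱.O n).mapQ (𝒱.O n) (𝒱.star n u) fun _ hx => 𝒱.star_mem_of_right_mem n u hx
      map_add' u u' := by
        refine Submodule.linearMap_qext _ (LinearMap.ext fun v => ?_)
        simp
      map_smul' c u := by
        refine Submodule.linearMap_qext _ (LinearMap.ext fun v => ?_)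
        simp }
    fun _ hx => Submodule.linearMap_qext _ <| LinearMap.ext fun v =>
      (Submodule.Quotient.mk_eq_zero _).2 (𝒱.star_mem_of_left_mem n hx v)

theorem cls_surjective (n : ℕ) : Function.Surjective (𝒱.cls n) := (𝒱.O n).mkQ_surjective

theorem cls_eq_cls_iff (n : ℕ) {u v : V} : 𝒱.cls n u = 𝒱.cls n v ↔ u - v ∈ 𝒱.O n :=
  Submodule.Quotient.eq _

/-- The ring structure of the level `n` Zhu algebra. -/
abbrev zhuRing (n : ℕ) : Ring (𝒱.Zhu n) :=
  { (inferInstance : AddCommGroup (𝒱.Zhu n)) with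
    mul x y := 𝒱.zhuMul n x y
    one := 𝒱.cls n 𝒱.vacuum
    left_distrib x y z := map_add (𝒱.zhuMul n x) y z
    right_distrib x y z := 𝒱.zhuMul n |>.map_add₂ x y z
    zero_mul x := (𝒱.zhuMul n).map_zero₂ x
    mul_zero x := map_zero (𝒱.zhuMul n x)
    mul_assoc x y z := by
      obtain ⟨u, rfl⟩ := 𝒱.cls_surjective n x
      obtain ⟨v, rfl⟩ := 𝒱.cls_surjective n y
      obtain ⟨w, rfl⟩ := 𝒱.cls_surjective n z
      exact (𝒱.cls_eq_cls_iff n).2 (𝒱.star_star_sub_star_star_mem n u v w)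
    one_mul x := by
      obtain ⟨u, rfl⟩ := 𝒱.cls_surjective n x
      exact congrArg (𝒱.cls n) (𝒱.star_vacuum_left n u)
    mul_one x := by
      obtain ⟨u, rfl⟩ := 𝒱.cls_surjective n x
      exact (𝒱.cls_eq_cls_iff n).2 (𝒱.star_vacuum_right_sub_mem n u) }

/-- The `ℂ`-algebra structure of the level `n` Zhu algebra. -/
abbrev zhuAlgebra (n : ℕ) : @Algebra ℂ (𝒱.Zhu n) _ (𝒱.zhuRing n).toSemiring :=
  letI := 𝒱.zhuRing n
  Algebra.ofModule' (R := ℂ) (A := 𝒱.Zhu n)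
    (fun r x => by
      show 𝒱.zhuMul n (r • 𝒱.cls n 𝒱.vacuum) x = r • x
      rw [map_smul, LinearMap.smul_apply]
      exact congrArg _ (one_mul x))
    (fun r x => by
      show 𝒱.zhuMul n x (r • 𝒱.cls n 𝒱.vacuum) = r • x
      rw [map_smul]
      exact congrArg _ (mul_one x))

/-- The presentation of `A_n(V)` by generators `v_j`. -/
theorem exists_isAlgIso_of_generates (n : ℕ) {J : Type*} (v : J → V)
    (hgen : 𝒱.Generates n (Set.range fun j => 𝒱.cls n (v j))) :
    ∃ I : TwoSidedIdeal (FreeAlgebra ℂ J), ∃ e : 𝒱.Zhu n ≃ₗ[ℂ] I.ringCon.Quotient,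
      𝒱.IsAlgIso n e ∧ (∀ j, e (𝒱.cls n (v j)) = I.ringCon.mk' (FreeAlgebra.ι ℂ j)) := by
  let _ := 𝒱.zhuRing n
  let _ := 𝒱.zhuAlgebra n
  let f : FreeAlgebra ℂ J →ₐ[ℂ] 𝒱.Zhu n := FreeAlgebra.lift ℂ fun j => 𝒱.cls n (v j)
  have hf : Function.Surjective f := by
    -- The range of `f` is a subspace of the kind tested by `Generates`, hence everything; the rest
    -- is the first isomorphism theorem for `f`.
    have h := hgen (LinearMap.range f.toLinearMap)
      (by rintro _ ⟨j, rfl⟩; exact ⟨FreeAlgebra.ι ℂ j, FreeAlgebra.lift_ι_apply _ _⟩)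
      ⟨1, map_one f⟩
      (by
        rintro u v ⟨x, hx⟩ ⟨y, hy⟩
        refine ⟨x * y, (map_mul f x y).trans ?_⟩
        exact congrArg₂ (· * ·) hx hy)
    exact LinearMap.range_eq_top.1 h
  have hker : Function.Bijective (RingCon.kerLift (f : FreeAlgebra ℂ J →+* 𝒱.Zhu n)) := by
    refine ⟨RingCon.kerLift_injective _, fun x => ?_⟩
    obtain ⟨y, rfl⟩ := hf x
    exact ⟨(y : (RingCon.ker (f : FreeAlgebra ℂ J →+* 𝒱.Zhu n)).Quotient), rfl⟩
  let g : (TwoSidedIdeal.ker f).ringCon.Quotient →ₗ[ℂ] 𝒱.Zhu n :=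
    { toFun := RingCon.kerLift (f : FreeAlgebra ℂ J →+* 𝒱.Zhu n)
      map_add' := map_add _
      map_smul' := by
        rintro c ⟨x⟩
        exact map_smul f c x }
  let e := LinearEquiv.ofBijective g hker
  refine ⟨TwoSidedIdeal.ker f, e.symm, ⟨?_, fun u v => ?_⟩, fun j => ?_⟩
  · rw [LinearEquiv.symm_apply_eq]
    exact (map_one (RingCon.kerLift (f : FreeAlgebra ℂ J →+* 𝒱.Zhu n))).symm
  · rw [LinearEquiv.symm_apply_eq]
    refine Eq.trans ?_ (map_mul (RingCon.kerLift (f : FreeAlgebra ℂ J →+* 𝒱.Zhu n)) _ _).symm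
    exact congrArg₂ (fun x y => 𝒱.zhuMul n x y) (e.apply_symm_apply (𝒱.cls n u)).symm
      (e.apply_symm_apply (𝒱.cls n v)).symm
  · rw [LinearEquiv.symm_apply_eq]
    exact (FreeAlgebra.lift_ι_apply (fun j => 𝒱.cls n (v j)) j).symm

/-! ### The projection between levels and the inclusion of ideals. -/

/-- The projection `A_{n+1}(V) → A_n(V)`. -/
def zhuProj (n : ℕ) : 𝒱.Zhu (n + 1) →ₗ[ℂ] 𝒱.Zhu n := Submodule.factor (𝒱.O_succ_le n)

theorem zhuProj_cls (n : ℕ) (u : V) : 𝒱.zhuProj n (𝒱.cls (n + 1) u) = 𝒱.cls n u := rfl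

theorem zhuProj_cls_star (n : ℕ) (u v : V) :
    𝒱.zhuProj n (𝒱.cls (n + 1) (𝒱.star (n + 1) u v)) = 𝒱.cls n (𝒱.star n u v) :=
  (𝒱.cls_eq_cls_iff n).2 (𝒱.star_succ_sub_star_mem n u v)

/-- The preimage under the projection of a subspace closed under `*_n` is closed under `*_{n+1}`. -/
theorem Generates.of_succ {n : ℕ} {J : Type*} {v : J → V}
    (hgen : 𝒱.Generates (n + 1) (Set.range fun j => 𝒱.cls (n + 1) (v j))) :
    𝒱.Generates n (Set.range fun j => 𝒱.cls n (v j)) := by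
  intro B hS h1 hmul
  have hB : ∀ u, 𝒱.cls (n + 1) u ∈ B.comap (𝒱.zhuProj n) ↔ 𝒱.cls n u ∈ B := fun u => by
    rw [Submodule.mem_comap, zhuProj_cls]
  have h : B.comap (𝒱.zhuProj n) = ⊤ := by
    refine hgen _ ?_ ((hB _).2 h1) fun u v hu hv => ?_
    · rintro _ ⟨j, rfl⟩
      exact (hB (v j)).2 (hS ⟨j, rfl⟩)
    · rw [Submodule.mem_comap, zhuProj_cls_star]
      exact hmul u v ((hB u).1 hu) ((hB v).1 hv)
  refine eq_top_iff.2 fun x _ => ?_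
  obtain ⟨u, rfl⟩ := 𝒱.cls_surjective n x
  exact (hB u).1 (h ▸ Submodule.mem_top)

/-- Transported to the quotients, the projection is an algebra map `g` fixing the classes of the
generators, so it carries the class of any `x` modulo `I` to its class modulo `I'`; elements of `I`
therefore vanish modulo `I'`. -/
theorem ideal_le_of_isAlgIso {n : ℕ} {J : Type*} {v : J → V} {I I' : TwoSidedIdeal (FreeAlgebra ℂ J)}
    {e : 𝒱.Zhu (n + 1) ≃ₗ[ℂ] I.ringCon.Quotient} (he : 𝒱.IsAlgIso (n + 1) e)
    (hev : ∀ j, e (𝒱.cls (n + 1) (v j)) = I.ringCon.mk' (FreeAlgebra.ι ℂ j))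
    {e' : 𝒱.Zhu n ≃ₗ[ℂ] I'.ringCon.Quotient} (he' : 𝒱.IsAlgIso n e')
    (hev' : ∀ j, e' (𝒱.cls n (v j)) = I'.ringCon.mk' (FreeAlgebra.ι ℂ j)) : I ≤ I' := by
  let g : I.ringCon.Quotient →ₗ[ℂ] I'.ringCon.Quotient :=
    e'.toLinearMap ∘ₗ 𝒱.zhuProj n ∘ₗ e.symm.toLinearMap
  have hg : ∀ u, g (e (𝒱.cls (n + 1) u)) = e' (𝒱.cls n u) := fun u =>
    congrArg (fun x => e' (𝒱.zhuProj n x)) (e.symm_apply_apply _)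
  have hone : g 1 = 1 := by rw [← he.map_one, hg, he'.map_one]
  have hmul : ∀ x y, g (x * y) = g x * g y := by
    intro x y
    obtain ⟨a, rfl⟩ := e.surjective x
    obtain ⟨b, rfl⟩ := e.surjective y
    obtain ⟨u, rfl⟩ := 𝒱.cls_surjective _ a
    obtain ⟨w, rfl⟩ := 𝒱.cls_surjective _ b
    rw [← he.map_mul, hg, hg, hg, ← he'.map_mul, ← zhuProj_cls_star, zhuProj_cls]
  have key : ∀ x, g (I.ringCon.mk' x) = I'.ringCon.mk' x := by
    intro x
    induction x using FreeAlgebra.induction with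
    | grade0 r =>
      have h1 : I.ringCon.mk' (algebraMap ℂ (FreeAlgebra ℂ J) r) = r • 1 := by
        rw [Algebra.algebraMap_eq_smul_one]; rfl
      have h2 : I'.ringCon.mk' (algebraMap ℂ (FreeAlgebra ℂ J) r) = r • 1 := by
        rw [Algebra.algebraMap_eq_smul_one]; rfl
      rw [h1, h2, map_smul, hone]
    | grade1 j => rw [← hev, hg, hev']
    | mul x y hx hy => rw [map_mul I.ringCon.mk', map_mul I'.ringCon.mk', hmul, hx, hy]
    | add x y hx hy => rw [map_add, map_add, map_add, hx, hy]
  intro x hx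
  rw [← TwoSidedIdeal.ker_ringCon_mk' I, TwoSidedIdeal.mem_ker] at hx
  rw [← TwoSidedIdeal.ker_ringCon_mk' I', TwoSidedIdeal.mem_ker, ← key, hx, map_zero]

end VertexOperatorAlgebra

end

theorem mainTheorem11 {V : Type*} [AddCommGroup V] [Module ℂ V] (𝒱 : VertexOperatorAlgebra V)
    (n : ℕ) (hn : 1 ≤ n) {J : Type*} (v : J → V)
    (hgen : 𝒱.Generates n (Set.range fun j => 𝒱.cls n (v j))) :
    𝒱.Generates (n - 1) (Set.range fun j => 𝒱.cls (n - 1) (v j)) ∧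
    ∃ I I' : TwoSidedIdeal (FreeAlgebra ℂ J),
      (∃ e : 𝒱.Zhu (n - 1) ≃ₗ[ℂ] I'.ringCon.Quotient, 𝒱.IsAlgIso (n - 1) e ∧
        ∀ j, e (𝒱.cls (n - 1) (v j)) = I'.ringCon.mk' (FreeAlgebra.ι ℂ j)) ∧
      (∃ e : 𝒱.Zhu n ≃ₗ[ℂ] I.ringCon.Quotient, 𝒱.IsAlgIso n e ∧
        ∀ j, e (𝒱.cls n (v j)) = I.ringCon.mk' (FreeAlgebra.ι ℂ j)) ∧
      I ≤ I' := by
  obtain ⟨n, rfl⟩ := Nat.exists_eq_add_of_le' hn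
  rw [Nat.add_sub_cancel]
  have hgen' := VertexOperatorAlgebra.Generates.of_succ 𝒱 hgen
  obtain ⟨I, e, he, hev⟩ := 𝒱.exists_isAlgIso_of_generates (n + 1) v hgen
  obtain ⟨I', e', he', hev'⟩ := 𝒱.exists_isAlgIso_of_generates n v hgen'
  exact ⟨hgen', I, I', ⟨e', he', hev'⟩, ⟨e, he, hev⟩, 𝒱.ideal_le_of_isAlgIso he hev he' hev'⟩
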